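/- Let $G$ be a locally compact Hausdorff topological group that is unimodular, with (bi-invariant, regular) Haar measure $\mu$. For $K,A\subseteq G$ put $\partial_K A:=K\overline{A}\cap K\overline{G\setminus A}$. A net $(A_i)_{i\in I}$ of compact subsets of $G$, indexed by a nonempty directed set, is called a *Van Hove net* in $G$ if $A_i$ has nonempty interior for all sufficiently large $i$ and $\lim_{i\in I}\mu(\partial_K A_i)/\mu(A_i)=0$ for every compact $K\subseteq G$; $G$ is called *amenable* if it admits a Van Hove net. A *uniform lattice* in $G$ is a discrete subgroup $\Lambda\subseteq G$ such that $G/\Lambda$ is compact; Van Hove nets in $\Lambda$ are taken with respect to the discrete topology and the counting measure on $\Lambda$. A *fundamental domain* of $\Lambda$ is a Borel measurable set $C\subseteq G$ with compact closure such that every $g\in G$ can be written in a unique way as $g=cz$ with $c\in C$ and $z\in\Lambda$. **Theorem.** Assume that $G$ is amenable and contains a uniform lattice. Let $f$ be a real-valued function on the set of nonempty compact subsets of $G$ that is - subadditive: $f(A\cup B)\le f(A)+f(B)$ for all nonempty compact $A,B\subseteq G$ (disjoint or not), - right invariant: $f(Ag)=f(A)$ for all nonempty compact $A\subseteq G$ and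 all $g\in G$, - monotone: $f(A)\le f(B)$ for all nonempty compact $A\subseteq B\subseteq G$. Then there is a real number $L$ such that, for every Van Hove net $(A_i)_{i\in I}$ in $G$, $$\lim_{i\in I}\frac{f(A_i)}{\mu(A_i)}=L .$$ In particular this limit exists, is finite and does not depend on the choice of the Van Hove net. Moreover, for every uniform lattice $\Lambda$ in $G$, every fundamental domain $C$ of $\Lambda$ and every Van Hove net $(F_j)_{j\in J}$ in $\Lambda$, the limit $\lim_{j\in J} f(\overline{C}F_j)/|F_j|$ exists, is finite, and $$L=\frac{1}{\mu(C)}\lim_{j\in J}\frac{f(\overline{C}F_j)}{|F_j|}.$$ -/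

import Mathlib

open Set Filter Topology MeasureTheory
open scoped Pointwise

universe u v w

namespace OrnsteinWeiss

/-- The `K`-boundary `∂_K A = K * closure A ∩ K * closure (Aᶜ)` of a set `A`. -/
def kBoundary {G : Type*} [Group G] [TopologicalSpace G] (K A : Set G) : Set G :=
  (K * closure A) ∩ (K * closure Aᶜ)

/-- A Van Hove net with respect to `μ`: a net (indexed by a directed set) of compact sets that
eventually have nonempty interior, such that `μ (∂_K A_i) / μ (A_i) → 0` for every compact `K`. -/
structure IsVanHoveNet {G : Type*} [Group G] [TopologicalSpace G] [MeasurableSpace G]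
    (μ : Measure G) {I : Type*} [Preorder I] (A : I → Set G) : Prop where
  isCompact : ∀ i, IsCompact (A i)
  finally_somewhere_dense : ∃ j, ∀ i, j ≤ i → (interior (A i)).Nonempty
  tendsto_boundary : ∀ K : Set G, IsCompact K →
    Tendsto (fun i => μ.real (kBoundary K (A i)) / μ.real (A i)) atTop (𝓝 0)

/-- Amenability of a unimodular group with (bi-invariant) Haar measure `μ`: there is a Van Hove
net. -/
def IsAmenable {G : Type u} [Group G] [TopologicalSpace G] [MeasurableSpace G]
    (μ : Measure G) : Prop :=
  ∃ (I : Type u) (_ : Preorder I) (_ : IsDirectedOrder I) (_ : Nonempty I) (A : I → Set G),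
    IsVanHoveNet μ A

/-- A uniform lattice: a discrete, co-compact subgroup. -/
structure IsUniformLattice {G : Type*} [Group G] [TopologicalSpace G]
    (Λ : Subgroup G) : Prop where
  discrete : DiscreteTopology Λ
  cocompact : CompactSpace (G ⧸ Λ)

/-- A (pre-compact, Borel measurable) fundamental domain `C` of `Λ`: every `g` can be written in a
unique way as `g = c * z` with `c ∈ C` and `z ∈ Λ`. -/
structure IsFundDomain {G : Type*} [Group G] [TopologicalSpace G] [MeasurableSpace G]
    (Λ : Subgroup G) (C : Set G) : Prop where
  existsUnique_mul : ∀ g : G, ∃! p : G × G, p.1 ∈ C ∧ p.2 ∈ Λ ∧ g = p.1 * p.2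
  isCompact_closure : IsCompact (closure C)
  measurableSet : MeasurableSet C

/-- Subadditivity, for a function on the nonempty compact subsets of `G` (the values of `f` on
other sets are irrelevant). -/
def SubadditiveOnCompacts {G : Type*} [TopologicalSpace G] (f : Set G → ℝ) : Prop :=
  ∀ A B : Set G, IsCompact A → A.Nonempty → IsCompact B → B.Nonempty → f (A ∪ B) ≤ f A + f B

/-- Right invariance, for a function on the nonempty compact subsets of `G`. -/
def RightInvariantOnCompacts {G : Type*} [Group G] [TopologicalSpace G] (f : Set G → ℝ) : Prop :=
  ∀ A : Set G, IsCompact A → A.Nonempty → ∀ g : G, f (A * {g}) = f A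

/-- Monotonicity, for a function on the nonempty compact subsets of `G`. -/
def MonotoneOnCompacts {G : Type*} [TopologicalSpace G] (f : Set G → ℝ) : Prop :=
  ∀ A B : Set G, IsCompact A → A.Nonempty → IsCompact B → A ⊆ B → f A ≤ f B

end OrnsteinWeiss

/-! The problem is discretised along a uniform lattice `Λ` with fundamental domain `C`. The tiles `C
z` partition `G`. For a Van Hove set `A`, let `F` be the set of `z ∈ Λ` for which `closure C * z`
meets `A`. Then `A ⊆ closure C * F`, and only tiles near the boundary of `A` stick out. Their number
is negligible against `μ A`, so monotonicity and subadditivity give `f A ≈ f (closure C * F)`, while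
`|F| μ(C) ≈ μ(A)`. Such `F` become invariant in `Λ`, so what remains is convergence of `f (closure C
* F) / |F|` along increasingly invariant finite sets (`exists_tendsto_invariantFilter`).

In the discrete group a single tile shape suffices. If liminf < limsup, a good invariant `F` has a
ratio clearly below the limsup. Almost disjoint translates of `F` fill a fixed proportion of any
sufficiently invariant `D`; the rest is small or still invariant, hence costs at most about the
limsup per point. So all such `D` have ratio below the limsup by a fixed amount, a contradiction.

One Van Hove net in `G`, evaluated through two lattices, shows that the constants agree. -/

namespace OrnsteinWeiss

/-! ### Ornstein–Weiss convergence in a discrete group -/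

section Discrete

variable {Γ : Type*} [Group Γ] [DecidableEq Γ]

/-- The filter of nonempty finite sets that become more and more invariant under left
translations. -/
def invariantFilter (Γ : Type*) [Group Γ] [DecidableEq Γ] : Filter (Finset Γ) :=
  ⨅ p : Finset Γ × {δ : ℝ // 0 < δ},
    𝓟 {A | A.Nonempty ∧ ∀ k ∈ p.1, ((k • A \ A).card : ℝ) ≤ p.2 * A.card}

theorem mem_invariantFilter {s : Set (Finset Γ)} :
    s ∈ invariantFilter Γ ↔ ∃ (K : Finset Γ) (δ : ℝ), 0 < δ ∧ ∀ A : Finset Γ, A.Nonempty →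
      (∀ k ∈ K, ((k • A \ A).card : ℝ) ≤ δ * A.card) → A ∈ s := by
  have : Nonempty {δ : ℝ // 0 < δ} := ⟨⟨1, one_pos⟩⟩
  rw [invariantFilter, mem_iInf_of_directed]
  · simp only [mem_principal, Prod.exists, Subtype.exists, Set.subset_def, mem_ofPred_eq, and_imp,
      exists_prop]
  · rintro ⟨K, δ, hδ⟩ ⟨K', δ', hδ'⟩
    refine ⟨⟨K ∪ K', min δ δ', lt_min hδ hδ'⟩, ?_, ?_⟩
    · refine principal_mono.2 fun A hA => ⟨hA.1, fun k hk => (hA.2 k ?_).trans ?_⟩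
      · exact Finset.mem_union_left _ hk
      · exact mul_le_mul_of_nonneg_right (min_le_left _ _) (Nat.cast_nonneg _)
    · refine principal_mono.2 fun A hA => ⟨hA.1, fun k hk => (hA.2 k ?_).trans ?_⟩
      · exact Finset.mem_union_right _ hk
      · exact mul_le_mul_of_nonneg_right (min_le_right _ _) (Nat.cast_nonneg _)

theorem tendsto_invariantFilter {ι : Type*} {l : Filter ι} {F : ι → Finset Γ}
    (hne : ∀ᶠ i in l, (F i).Nonempty)
    (hF : ∀ k : Γ, Tendsto (fun i => ((k • F i \ F i).card : ℝ) / (F i).card) l (𝓝 0)) :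
    Tendsto F l (invariantFilter Γ) := by
  intro s hs
  obtain ⟨K, δ, hδ, h⟩ := mem_invariantFilter.1 hs
  have h1 : ∀ᶠ i in l, ∀ k ∈ K, ((k • F i \ F i).card : ℝ) / (F i).card < δ :=
    (Filter.eventually_all_finset K).2 fun k _ => (hF k).eventually_lt_const hδ
  change ∀ᶠ i in l, F i ∈ s
  filter_upwards [hne, h1] with i hi hi'
  refine h _ hi fun k hk => ?_
  have hpos : (0 : ℝ) < (F i).card := Nat.cast_pos.2 hi.card_pos
  exact ((div_lt_iff₀ hpos).1 (hi' k hk)).le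

theorem mem_finset_mul_singleton {A : Finset Γ} {c x : Γ} :
    x ∈ A * {c} ↔ ∃ y ∈ A, y * c = x := by
  simp [Finset.mem_mul]

theorem card_sdiff_smul (k : Γ) (A : Finset Γ) : (A \ k • A).card = (k • A \ A).card := by
  rw [Finset.card_sdiff_comm]
  exact (Finset.card_smul_finset k A).symm

/-- A maximal family of almost disjoint right translates of `F` inside `D` covers a definite
proportion of `D`. -/
theorem exists_almost_disjoint_translates (F D : Finset Γ) (hF : F.Nonempty) {ε : ℝ}
    (hε1 : ε ≤ 1) :
    ∃ T : Finset Γ, F * T ⊆ D ∧ (1 - ε) * (F.card * T.card) ≤ (F * T).card ∧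
      ε * ({c ∈ D | F * {c} ⊆ D} : Finset Γ).card ≤ (F * T).card := by
  set R : Finset Γ := {c ∈ D | F * {c} ⊆ D} with hR
  have hFpos : (0 : ℝ) < F.card := Nat.cast_pos.2 hF.card_pos
  set 𝒯 : Finset (Finset Γ) :=
    {T ∈ R.powerset | (1 - ε) * (F.card * T.card) ≤ ((F * T).card : ℝ)} with h𝒯
  have hne : 𝒯.Nonempty := ⟨∅, by simp [h𝒯]⟩
  obtain ⟨T, hT, hmax⟩ := 𝒯.exists_max_image Finset.card hne
  obtain ⟨hTR, hTc⟩ := Finset.mem_filter.1 hT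
  rw [Finset.mem_powerset] at hTR
  refine ⟨T, ?_, hTc, ?_⟩
  · intro x hx
    obtain ⟨y, hy, c, hc, rfl⟩ := Finset.mem_mul.1 hx
    exact (Finset.mem_filter.1 (hTR hc)).2 (Finset.mul_mem_mul hy (Finset.mem_singleton_self c))
  -- By maximality, adding a new centre `c` breaks almost disjointness, so its translate already
  -- overlaps `F * T` in a proportion at least `ε`.
  have key : ∀ c ∈ R, ε * F.card ≤ ((F * {c} ∩ (F * T)).card : ℝ) := by
    intro c hc
    by_cases hcT : c ∈ T
    · rw [Finset.inter_eq_left.2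
        (Finset.mul_subset_mul_left (Finset.singleton_subset_iff.2 hcT)),
        Finset.card_mul_singleton]
      nlinarith
    · have hnot : insert c T ∉ 𝒯 := fun h => by
        have := hmax _ h
        rw [Finset.card_insert_of_notMem hcT] at this
        omega
      have h1 : ((F * insert c T).card : ℝ) < (1 - ε) * (F.card * (insert c T).card) := by
        by_contra! h
        exact hnot (Finset.mem_filter.2
          ⟨Finset.mem_powerset.2 (Finset.insert_subset hc hTR), h⟩)
      rw [Finset.card_insert_of_notMem hcT, Finset.insert_eq, Finset.mul_union] at h1
      have h2 := Finset.card_union_add_card_inter (F * {c}) (F * T)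
      rw [Finset.card_mul_singleton] at h2
      have h3 : ((F * {c} ∪ F * T).card : ℝ) + (F * {c} ∩ (F * T)).card
        = F.card + (F * T).card := by exact_mod_cast h2
      push_cast at h1
      nlinarith
  -- Double counting: for fixed `y ∈ F` the map `c ↦ y * c` is injective, so at most `|F * T|`
  -- centres satisfy `y * c ∈ F * T`.
  have hsum : ∑ c ∈ R, (F * {c} ∩ (F * T)).card ≤ F.card * (F * T).card := by
    have : ∀ c ∈ R, (F * {c} ∩ (F * T)).card = ∑ y ∈ F, if y * c ∈ F * T then 1 else 0 := by
      intro c _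
      rw [← Finset.card_filter, Finset.inter_comm, ← Finset.filter_mem_eq_inter,
        ← Finset.card_mul_singleton (Finset.filter _ F) c]
      congr 1
      ext x
      simp only [Finset.mem_filter, mem_finset_mul_singleton]
      constructor
      · rintro ⟨h, y, hy, rfl⟩; exact ⟨y, ⟨hy, h⟩, rfl⟩
      · rintro ⟨y, ⟨hy, h⟩, rfl⟩; exact ⟨h, y, hy, rfl⟩
    rw [Finset.sum_congr rfl this, Finset.sum_comm, ← smul_eq_mul (a := F.card),
      ← Finset.sum_const]
    refine Finset.sum_le_sum fun y _ => ?_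
    rw [← Finset.card_filter]
    refine Finset.card_le_card_of_injOn (fun c => y * c) ?_ ?_
    · intro c hc; exact (Finset.mem_filter.1 hc).2
    · intro a _ b _ h; exact mul_left_cancel h
  have h4 : (R.card : ℝ) * (ε * F.card) ≤ F.card * (F * T).card := by
    calc (R.card : ℝ) * (ε * F.card) = ∑ c ∈ R, ε * (F.card : ℝ) := by simp
      _ ≤ ∑ c ∈ R, ((F * {c} ∩ (F * T)).card : ℝ) := Finset.sum_le_sum key
      _ ≤ _ := by exact_mod_cast hsum
  nlinarith

theorem card_smul_mul_sdiff_le (k : Γ) (F T : Finset Γ) :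
    (k • (F * T) \ (F * T)).card ≤ (k • F \ F).card * T.card := by
  refine (Finset.card_le_card ?_).trans (Finset.card_mul_le (s := k • F \ F) (t := T))
  intro x hx
  obtain ⟨h1, h2⟩ := Finset.mem_sdiff.1 hx
  rw [← smul_mul_assoc] at h1
  obtain ⟨y, hy, c, hc, rfl⟩ := Finset.mem_mul.1 h1
  exact Finset.mul_mem_mul
    (Finset.mem_sdiff.2 ⟨hy, fun h => h2 (Finset.mul_mem_mul h hc)⟩) hc

theorem card_smul_sdiff_sdiff_le (k : Γ) (D E : Finset Γ) :
    (k • (D \ E) \ (D \ E)).card ≤ (k • D \ D).card + (k • E \ E).card := by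
  rw [← card_sdiff_smul k E]
  refine (Finset.card_le_card ?_).trans (Finset.card_union_le _ _)
  intro x
  simp only [Finset.mem_sdiff, Finset.mem_union, ← Finset.inv_smul_mem_iff]
  tauto

/-- A bad centre lies in `D \ k⁻¹ • D` for some `k ∈ F`. These are `|F|` sets of size at most `|D| /
(2|F|)`, so at most half of `D` is bad. -/
theorem card_le_two_mul_card_filter (F D : Finset Γ) (hF : F.Nonempty)
    (hD : ∀ k ∈ F, ((k • D \ D).card : ℝ) ≤ 1 / (2 * F.card) * D.card) :
    (D.card : ℝ) ≤ 2 * ({c ∈ D | F * {c} ⊆ D} : Finset Γ).card := by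
  have hFpos : (0 : ℝ) < F.card := Nat.cast_pos.2 hF.card_pos
  have h1 : (({c ∈ D | ¬ F * {c} ⊆ D} : Finset Γ).card : ℝ) ≤ D.card / 2 := by
    have hsub : ({c ∈ D | ¬ F * {c} ⊆ D} : Finset Γ) ⊆ F.biUnion fun k => D \ k⁻¹ • D := by
      intro c hc
      obtain ⟨hcD, h⟩ := Finset.mem_filter.1 hc
      obtain ⟨x, hx, hxD⟩ := Finset.not_subset.1 h
      obtain ⟨y, hy, rfl⟩ := mem_finset_mul_singleton.1 hx
      refine Finset.mem_biUnion.2 ⟨y, hy, Finset.mem_sdiff.2 ⟨hcD, fun h => hxD ?_⟩⟩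
      rwa [← Finset.inv_smul_mem_iff, inv_inv] at h
    calc (({c ∈ D | ¬ F * {c} ⊆ D} : Finset Γ).card : ℝ)
        ≤ ∑ k ∈ F, ((D \ k⁻¹ • D).card : ℝ) := by
          exact_mod_cast (Finset.card_le_card hsub).trans Finset.card_biUnion_le
      _ ≤ ∑ k ∈ F, 1 / (2 * F.card) * (D.card : ℝ) := by
          refine Finset.sum_le_sum fun k hk => ?_
          refine le_trans (le_of_eq ?_) (hD k hk)
          rw [← Finset.card_smul_finset k (D \ k⁻¹ • D), Finset.smul_finset_sdiff,
            smul_inv_smul]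
      _ = D.card / 2 := by
          rw [Finset.sum_const, nsmul_eq_mul]; field_simp
  have h2 : (({c ∈ D | F * {c} ⊆ D} : Finset Γ).card : ℝ)
      + ({c ∈ D | ¬ F * {c} ⊆ D} : Finset Γ).card = D.card := by
    exact_mod_cast Finset.card_filter_add_card_filter_not (s := D) (fun c => F * {c} ⊆ D)
  linarith

variable {f : Finset Γ → ℝ}

theorem apply_mul_le (h0 : f ∅ = 0) (hsub : ∀ A B, f (A ∪ B) ≤ f A + f B)
    (hinv : ∀ A g, f (A * {g}) = f A) (F T : Finset Γ) : f (F * T) ≤ T.card * f F := by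
  induction T using Finset.induction_on with
  | empty => simp [h0]
  | insert c T hc ih =>
    rw [Finset.insert_eq, Finset.mul_union, ← Finset.insert_eq, Finset.card_insert_of_notMem hc]
    push_cast
    linarith [hsub (F * {c}) (F * T), hinv F c]

/-- The Ornstein–Weiss lemma for nonnegative functions on a discrete group. -/
theorem exists_tendsto_invariantFilter [(invariantFilter Γ).NeBot] (h0 : f ∅ = 0)
    (hnn : ∀ A, 0 ≤ f A) (hsub : ∀ A B, f (A ∪ B) ≤ f A + f B)
    (hinv : ∀ A g, f (A * {g}) = f A) :
    ∃ M : ℝ, Tendsto (fun A => f A / A.card) (invariantFilter Γ) (𝓝 M) := by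
  set q : Finset Γ → ℝ := fun A => f A / A.card with hq
  set l := invariantFilter Γ
  have hf1 : ∀ A, f A ≤ f {1} * A.card := fun A => by
    have := apply_mul_le h0 hsub hinv {1} A
    rwa [Finset.singleton_one, one_mul, mul_comm] at this
  have hq0 : ∀ A, 0 ≤ q A := fun A => div_nonneg (hnn A) (Nat.cast_nonneg _)
  have hq1 : ∀ A, q A ≤ f {1} := fun A =>
    div_le_of_le_mul₀ (Nat.cast_nonneg _) (hnn _) (hf1 A)
  have hbu : IsBoundedUnder (· ≤ ·) l q := isBoundedUnder_of ⟨f {1}, hq1⟩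
  have hbl : IsBoundedUnder (· ≥ ·) l q := isBoundedUnder_of ⟨0, hq0⟩
  refine ⟨limsup q l, tendsto_of_le_liminf_of_limsup_le ?_ le_rfl hbu hbl⟩
  by_contra! hlt
  set S := limsup q l
  obtain ⟨a, hma, haS⟩ := exists_between hlt
  have hm0 : 0 ≤ liminf q l :=
    le_liminf_of_le hbu.isCoboundedUnder_ge (Eventually.of_forall hq0)
  have ha : 0 < a := hm0.trans_lt hma
  -- The factor `1 - ε` pays for the overlaps of the translates: `f F ≤ (1 - ε) a |F|` will yield `f
  -- (F * T) ≤ a |F * T|`.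
  obtain ⟨ε, hε, hε1, hεa⟩ : ∃ ε : ℝ, 0 < ε ∧ ε < 1 ∧ liminf q l < (1 - ε) * a := by
    refine ⟨(a - liminf q l) / (2 * a), by apply div_pos <;> linarith, ?_, ?_⟩
    · rw [div_lt_one (by positivity)]; linarith
    · have : (1 - (a - liminf q l) / (2 * a)) * a = (a + liminf q l) / 2 := by
        field_simp; ring
      linarith
  have hf1nn : 0 ≤ f {1} := hnn _
  -- Chosen so that the total error `η (1 + f {1})` is half of the gain `(S - a) ε / 2`.
  set η : ℝ := (S - a) * ε / (4 * (1 + f {1})) with hη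
  have hηpos : 0 < η := by
    have : 0 < S - a := sub_pos.2 haS
    positivity
  have hηeq : η * (1 + f {1}) = (S - a) * ε / 4 := by rw [hη]; field_simp
  obtain ⟨K, δ, hδ, hK⟩ := mem_invariantFilter.1
    (eventually_lt_of_limsup_lt (show limsup q l < S + η by linarith) hbu)
  have hfreq : ∃ᶠ A in l, q A < (1 - ε) * a := frequently_lt_of_liminf_lt hbu.isCoboundedUnder_ge hεa
  -- With `(1 - ε)|F||T| ≤ |F * T| ≤ |D|`, this tolerance bounds the boundary of `F * T` by `η δ / 2
  -- * |D|`; the other half of the budget is for `D`.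
  have hev : ∀ᶠ A in l, A.Nonempty ∧
      ∀ k ∈ K, ((k • A \ A).card : ℝ) ≤ (η * δ * (1 - ε) / 2) * A.card := by
    have : 0 < 1 - ε := by linarith
    exact mem_invariantFilter.2 ⟨K, _, by positivity, fun A h1 h2 => ⟨h1, h2⟩⟩
  obtain ⟨F, hFq, hFne, hFinv⟩ := (hfreq.and_eventually hev).exists
  have hFpos : (0 : ℝ) < F.card := Nat.cast_pos.2 hFne.card_pos
  have hfF : f F ≤ (1 - ε) * a * F.card := ((div_lt_iff₀ hFpos).1 hFq).le
  have hmain : ∀ᶠ D in l, q D ≤ S - (S - a) * ε / 4 := by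
    refine mem_invariantFilter.2 ⟨K ∪ F, min (η * δ / 2) (1 / (2 * F.card)),
      lt_min (by positivity) (by positivity), fun D hDne hD => ?_⟩
    have hDpos : (0 : ℝ) < D.card := Nat.cast_pos.2 hDne.card_pos
    have hD2 := card_le_two_mul_card_filter F D hFne fun k hk =>
      (hD k (Finset.mem_union_right _ hk)).trans
        (mul_le_mul_of_nonneg_right (min_le_right _ _) hDpos.le)
    obtain ⟨T, hTD, hT1, hT2⟩ := exists_almost_disjoint_translates F D hFne hε1.le
    set E := F * T
    have hED : (E.card : ℝ) + (D \ E).card = D.card := by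
      exact_mod_cast (add_comm _ _).trans (Finset.card_sdiff_add_card_eq_card hTD)
    have hE : ε / 2 * D.card ≤ E.card := by nlinarith
    have hfE : f E ≤ a * E.card := by
      have h1 := apply_mul_le h0 hsub hinv F T
      have h2 : (T.card : ℝ) * f F ≤ T.card * ((1 - ε) * a * F.card) :=
        mul_le_mul_of_nonneg_left hfF (Nat.cast_nonneg _)
      nlinarith
    -- A remainder of size at most `η |D|` is bounded trivially through `f {1}`; a larger one
    -- inherits enough invariance for its ratio to be below `S + η`.
    have hfD' : f (D \ E) ≤ S * (D \ E).card + η * (1 + f {1}) * D.card := by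
      have hS0 : 0 ≤ S := (ha.trans haS).le
      have hc0 : (0 : ℝ) ≤ (D \ E).card := Nat.cast_nonneg _
      rcases le_or_gt ((D \ E).card : ℝ) (η * D.card) with hsm | hbig
      · have h1 := hf1 (D \ E)
        have h2 := mul_le_mul_of_nonneg_left hsm hf1nn
        have h3 := mul_nonneg hS0 hc0
        have h4 : 0 ≤ η * D.card := by positivity
        nlinarith
      · have hpos : (0 : ℝ) < (D \ E).card := lt_trans (by positivity) hbig
        have hlt : q (D \ E) < S + η := by
          refine hK _ (Finset.card_pos.1 (by exact_mod_cast hpos)) fun k hk => ?_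
          have h1 : ((k • (D \ E) \ (D \ E)).card : ℝ)
              ≤ (k • D \ D).card + (k • E \ E).card := by
            exact_mod_cast card_smul_sdiff_sdiff_le k D E
          have h2 : ((k • D \ D).card : ℝ) ≤ η * δ / 2 * D.card :=
            (hD k (Finset.mem_union_left _ hk)).trans
              (mul_le_mul_of_nonneg_right (min_le_left _ _) hDpos.le)
          have h3 : ((k • E \ E).card : ℝ) ≤ (k • F \ F).card * T.card := by
            exact_mod_cast card_smul_mul_sdiff_le k F T
          have h4 : ((k • F \ F).card : ℝ) * T.card
              ≤ (η * δ * (1 - ε) / 2) * F.card * T.card :=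
            mul_le_mul_of_nonneg_right (hFinv k hk) (Nat.cast_nonneg _)
          have h5 : (η * δ / 2) * ((1 - ε) * (F.card * T.card)) ≤ (η * δ / 2) * D.card :=
            mul_le_mul_of_nonneg_left (by linarith) (by positivity)
          have h6 : δ * (η * D.card) ≤ δ * (D \ E).card :=
            mul_le_mul_of_nonneg_left hbig.le hδ.le
          nlinarith
        have h1 := (div_lt_iff₀ hpos).1 hlt
        have h2 : η * (D \ E).card ≤ η * D.card :=
          mul_le_mul_of_nonneg_left (by linarith [Nat.cast_nonneg (α := ℝ) E.card]) hηpos.le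
        have h3 : 0 ≤ η * f {1} * D.card := by positivity
        nlinarith
    have hfD : f D ≤ f E + f (D \ E) := by
      have := hsub E (D \ E)
      rwa [Finset.union_sdiff_of_subset hTD] at this
    rw [hηeq] at hfD'
    rw [hq, mem_ofPred_eq, div_le_iff₀ hDpos]
    have h1 : (S - a) * (ε / 2 * D.card) ≤ (S - a) * E.card :=
      mul_le_mul_of_nonneg_left hE (by linarith)
    have h2 : ((D \ E).card : ℝ) = D.card - E.card := by linarith
    rw [h2] at hfD'
    linarith
  have hle : S ≤ S - (S - a) * ε / 4 :=
    limsup_le_of_le hbl.isCoboundedUnder_le hmain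
  nlinarith [mul_pos (sub_pos.2 haS) hε]

end Discrete

/-! ### Existence of fundamental domains -/

section Lattice

variable {G : Type*} [Group G] [TopologicalSpace G] [IsTopologicalGroup G]

theorem exists_mul_disjoint_nhds (Λ : Subgroup G) [DiscreteTopology Λ] :
    ∃ U : Set G, IsOpen U ∧ (1 : G) ∈ U ∧ ∀ x ∈ U, ∀ y ∈ U, x⁻¹ * y ∈ Λ → x = y := by
  obtain ⟨V, hV, hV1⟩ := (isOpen_induced_iff (f := ((↑) : Λ → G))).1
    (isOpen_discrete ({1} : Set Λ))
  have h1V : (1 : G) ∈ V := by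
    have : (1 : Λ) ∈ ((↑) : Λ → G) ⁻¹' V := by rw [hV1]; rfl
    exact this
  have hc : Continuous fun p : G × G => p.1⁻¹ * p.2 := by fun_prop
  have hn : (fun p : G × G => p.1⁻¹ * p.2) ⁻¹' V ∈ 𝓝 ((1 : G), (1 : G)) :=
    hc.continuousAt.preimage_mem_nhds (by simpa using hV.mem_nhds h1V)
  rw [nhds_prod_eq, mem_prod_same_iff] at hn
  obtain ⟨W, hW, hWV⟩ := hn
  obtain ⟨U, hUW, hU, h1U⟩ := mem_nhds_iff.1 hW
  refine ⟨U, hU, h1U, fun x hx y hy hxy => ?_⟩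
  have hm : x⁻¹ * y ∈ V := hWV (mk_mem_prod (hUW hx) (hUW hy))
  have : (⟨x⁻¹ * y, hxy⟩ : Λ) ∈ ((↑) : Λ → G) ⁻¹' V := hm
  rw [hV1, mem_singleton_iff, Subtype.ext_iff] at this
  exact inv_mul_eq_one.1 this

/-- Finitely many translates `x U`, each meeting every coset at most once, cover the compact
quotient. Greedily, each contributes only the points whose cosets are not yet represented. -/
theorem IsUniformLattice.exists_isFundDomain [T2Space G] [LocallyCompactSpace G]
    [MeasurableSpace G] [BorelSpace G] {Λ : Subgroup G} (hΛ : IsUniformLattice Λ) : ∃ C : Set G, IsFundDomain Λ C := by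
  have := hΛ.discrete
  have := hΛ.cocompact
  obtain ⟨U₀, hU₀, h1U₀, hinj₀⟩ := exists_mul_disjoint_nhds Λ
  obtain ⟨P, hP, h1P⟩ := exists_compact_mem_nhds (1 : G)
  set U := U₀ ∩ interior P with hUdef
  have hU : IsOpen U := hU₀.inter isOpen_interior
  have h1U : (1 : G) ∈ U := ⟨h1U₀, mem_interior_iff_mem_nhds.2 h1P⟩
  have hinj : ∀ x ∈ U, ∀ y ∈ U, x⁻¹ * y ∈ Λ → x = y := fun x hx y hy => hinj₀ x hx.1 y hy.1
  have hopen : ∀ x : G, IsOpen (({x} : Set G) * U) := fun x => hU.mul_left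
  -- Recording `C * Λ = s * U * Λ` keeps the saturation open, so the set removed at each stage is
  -- Borel.
  have step : ∀ s : Finset G, ∃ C : Set G, MeasurableSet C ∧ C ⊆ ((s : Set G) * P) ∧
      C * (Λ : Set G) = (s : Set G) * U * (Λ : Set G) ∧
      ∀ x ∈ C, ∀ y ∈ C, x⁻¹ * y ∈ Λ → x = y := by
    classical
    intro s
    induction s using Finset.induction_on with
    | empty => exact ⟨∅, MeasurableSet.empty, by simp, by simp, by simp⟩
    | insert a s _ ih =>
      obtain ⟨C, hCm, hCP, hCΛ, hCi⟩ := ih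
      have hO : IsOpen (C * (Λ : Set G)) := by
        rw [hCΛ]; exact (hU.mul_left).mul_right
      have hstab : ∀ x y : G, x⁻¹ * y ∈ Λ → x ∈ C * (Λ : Set G) → y ∈ C * (Λ : Set G) := by
        rintro _ y hxy ⟨c, hc, z, hz, rfl⟩
        exact ⟨c, hc, _, Λ.mul_mem hz hxy, by group⟩
      have hCsub : C ⊆ C * (Λ : Set G) := fun c hc => ⟨c, hc, 1, Λ.one_mem, mul_one c⟩
      refine ⟨C ∪ ({a} * U) \ (C * (Λ : Set G)),
        hCm.union ((hopen a).measurableSet.diff hO.measurableSet), ?_, ?_, ?_⟩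
      · rw [Finset.coe_insert, insert_eq, union_mul, union_comm]
        refine union_subset_union (sdiff_subset.trans (mul_subset_mul_left ?_)) hCP
        exact inter_subset_right.trans interior_subset
      · rw [Finset.coe_insert, insert_eq, union_mul, union_mul, union_mul, ← hCΛ]
        apply Subset.antisymm
        · rw [union_comm]
          exact union_subset_union (mul_subset_mul_right sdiff_subset) Subset.rfl
        · rintro x (hx | hx)
          · by_cases hxC : x ∈ C * (Λ : Set G)
            · exact Or.inl hxC
            · obtain ⟨y, hy, z, hz, rfl⟩ := hx
              refine Or.inr ⟨y, ⟨hy, fun h => hxC (hstab _ _ ?_ h)⟩, z, hz, rfl⟩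
              simpa using hz
          · exact Or.inl hx
      · rintro x (hx | ⟨hx, hx'⟩) y (hy | ⟨hy, hy'⟩) hxy
        · exact hCi x hx y hy hxy
        · exact absurd (hstab _ _ hxy (hCsub hx)) hy'
        · refine absurd (hstab _ _ ?_ (hCsub hy)) hx'
          simpa using Λ.inv_mem hxy
        · rw [singleton_mul] at hx hy
          obtain ⟨u, hu, rfl⟩ := hx
          obtain ⟨v, hv, rfl⟩ := hy
          have : u⁻¹ * v ∈ Λ := by simpa [mul_assoc] using hxy
          rw [hinj u hu v hv this]
  obtain ⟨s, hs⟩ := isCompact_univ.elim_finite_subcover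
    (fun x : G => ((↑) : G → G ⧸ Λ) '' (({x} : Set G) * U))
    (fun x => QuotientGroup.isOpenMap_coe _ (hopen x)) (fun q _ => by
      induction q using QuotientGroup.induction_on with
      | H x => exact mem_iUnion.2 ⟨x, x, ⟨x, rfl, 1, h1U, mul_one x⟩, rfl⟩)
  obtain ⟨C, hCm, hCP, hCΛ, hCi⟩ := step s
  refine ⟨C, fun g => ?_, ?_, hCm⟩
  · have hg : g ∈ C * (Λ : Set G) := by
      rw [hCΛ]
      obtain ⟨x, hx⟩ := mem_iUnion.1 (hs (mem_univ (g : G ⧸ Λ)))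
      obtain ⟨hxs, y, ⟨_, rfl, u, hu, rfl⟩, hy⟩ := mem_iUnion.1 hx
      exact ⟨_, ⟨_, hxs, u, hu, rfl⟩, _, QuotientGroup.eq.1 hy, by group⟩
    obtain ⟨c, hc, z, hz, rfl⟩ := hg
    refine ⟨(c, z), ⟨hc, hz, rfl⟩, ?_⟩
    rintro ⟨c', z'⟩ ⟨hc', hz', h⟩
    dsimp only at hc' hz' h
    have hcc : c = c' := by
      refine hCi c hc c' hc' ?_
      have : c⁻¹ * c' = z * z'⁻¹ := by
        rw [inv_mul_eq_iff_eq_mul, ← mul_assoc, eq_mul_inv_iff_mul_eq]; exact h.symm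
      rw [this]
      exact Λ.mul_mem hz (Λ.inv_mem hz')
    subst hcc
    rw [mul_left_cancel h]
  · exact (s.finite_toSet.isCompact.mul hP).closure_of_subset hCP

end Lattice

/-! ### Van Hove nets in discrete groups -/

section VanHove

/-- A Van Hove net in a discrete group converges to `invariantFilter`. -/
theorem IsVanHoveNet.tendsto_invariantFilter {Γ : Type*} [Group Γ] [DecidableEq Γ]
    [TopologicalSpace Γ] [DiscreteTopology Γ] [MeasurableSpace Γ] [MeasurableSingletonClass Γ]
    {J : Type*} [Preorder J] {F : J → Set Γ} (hF : IsVanHoveNet (Measure.count : Measure Γ) F) :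
    Tendsto (fun j => ((hF.isCompact j).finite_of_discrete).toFinset) atTop
      (invariantFilter Γ) := by
  have hfin : ∀ j, (F j).Finite := fun j => (hF.isCompact j).finite_of_discrete
  have hcount : ∀ s : Finset Γ, (Measure.count : Measure Γ).real s = s.card := fun s => by
    rw [measureReal_def, Measure.count_apply_finset]; simp
  refine OrnsteinWeiss.tendsto_invariantFilter ?_ fun k => ?_
  · obtain ⟨j₀, hj₀⟩ := hF.finally_somewhere_dense
    refine (eventually_ge_atTop j₀).mono fun j hj => ?_
    rw [Finite.toFinset_nonempty]
    exact (hj₀ j hj).mono interior_subset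
  · have hK : ({1, k} : Set Γ).Finite := by simp
    refine squeeze_zero (fun j => by positivity) (fun j => ?_)
      (hF.tendsto_boundary {1, k} hK.isCompact)
    have hFc : (Measure.count : Measure Γ).real (F j) = (hfin j).toFinset.card := by
      rw [← hcount, Finite.coe_toFinset]
    rw [hFc]
    refine div_le_div_of_nonneg_right ?_ (Nat.cast_nonneg _)
    have hbfin : (kBoundary {1, k} (F j)).Finite := by
      refine Finite.subset ((hK.mul (hfin j))) ?_
      rw [kBoundary, closure_discrete]; exact inter_subset_left
    rw [← hcount]
    refine measureReal_mono ?_ (Measure.count_apply_lt_top.2 hbfin).ne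
    intro x hx
    simp only [Finset.coe_sdiff, Finset.coe_smul_finset, Finite.coe_toFinset] at hx
    simp only [kBoundary, closure_discrete]
    obtain ⟨⟨y, hy, rfl⟩, hx2⟩ := hx
    exact ⟨⟨k, by simp, y, hy, rfl⟩, ⟨1, by simp, _, hx2, one_mul _⟩⟩

end VanHove

/-! ### Transfer between the group and the lattice -/

section Transfer

variable {G : Type*} [Group G] [TopologicalSpace G]

theorem mem_kBoundary_of_notMem {K A : Set G} {x : G} (h1 : (1 : G) ∈ K) (hx : x ∈ K * A)
    (hxA : x ∉ A) : x ∈ kBoundary K A :=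
  ⟨mul_subset_mul_left subset_closure hx,
    mul_subset_mul_left subset_closure ⟨1, h1, x, hxA, one_mul x⟩⟩

theorem mem_kBoundary {K A : Set G} {x : G} (hx : x ∈ K * A) (hx' : x ∈ K * Aᶜ) :
    x ∈ kBoundary K A :=
  ⟨mul_subset_mul_left subset_closure hx, mul_subset_mul_left subset_closure hx'⟩

theorem SubadditiveOnCompacts.nonneg {X : Type*} [TopologicalSpace X] {f : Set X → ℝ}
    (hf_sub : SubadditiveOnCompacts f) {A : Set X} (hA : IsCompact A) (hne : A.Nonempty) :
    0 ≤ f A := by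
  have := hf_sub A A hA hne hA hne
  rw [union_self] at this
  linarith

variable {Λ : Subgroup G} {C : Set G}

omit [TopologicalSpace G] in
theorem mem_mul_singleton {A : Set G} {g x : G} : x ∈ A * {g} ↔ ∃ a ∈ A, a * g = x := by
  simp only [Set.mem_mul, mem_singleton_iff, exists_eq_left]

variable [MeasurableSpace G]

namespace IsFundDomain

theorem exists_mul (hC : IsFundDomain Λ C) (g : G) : ∃ c ∈ C, ∃ z : Λ, c * z = g := by
  obtain ⟨⟨c, z⟩, ⟨hc, hz, h⟩, -⟩ := hC.existsUnique_mul g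
  exact ⟨c, hc, ⟨z, hz⟩, h.symm⟩

theorem nonempty (hC : IsFundDomain Λ C) : C.Nonempty :=
  let ⟨c, hc, _⟩ := hC.exists_mul 1
  ⟨c, hc⟩

theorem disjoint_mul_singleton (hC : IsFundDomain Λ C) {z w : Λ} (h : z ≠ w) :
    Disjoint (C * {(z : G)}) (C * {(w : G)}) := by
  rw [Set.disjoint_left]
  intro x hx hx'
  obtain ⟨c, hc, rfl⟩ := mem_mul_singleton.1 hx
  obtain ⟨d, hd, hdc⟩ := mem_mul_singleton.1 hx'
  have := (hC.existsUnique_mul (c * z)).unique (y₁ := (c, (z : G))) (y₂ := (d, (w : G)))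
    ⟨hc, z.2, rfl⟩ ⟨hd, w.2, hdc.symm⟩
  exact h (Subtype.ext (Prod.ext_iff.1 this).2)

variable [BorelSpace G] [IsTopologicalGroup G]

theorem measurableSet_mul_singleton (hC : IsFundDomain Λ C) (g : G) :
    MeasurableSet (C * {g}) := by
  have : C * {g} = (fun x => x * g⁻¹) ⁻¹' C := by ext x; simp
  rw [this]
  exact (measurable_mul_const _) hC.measurableSet

variable (μ : Measure G) [μ.IsHaarMeasure] [μ.IsMulRightInvariant]

omit [BorelSpace G] [IsTopologicalGroup G] [μ.IsMulRightInvariant] in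
theorem measure_lt_top (hC : IsFundDomain Λ C) : μ C < ⊤ :=
  (measure_mono subset_closure).trans_lt hC.isCompact_closure.measure_lt_top

omit [μ.IsHaarMeasure] in
theorem measureReal_biUnion (hC : IsFundDomain Λ C) (B : Finset Λ) :
    μ.real (⋃ w ∈ B, C * {(w : G)}) = B.card * μ.real C := by
  rw [measureReal_def, measure_biUnion_finset
    (fun z _ w _ h => hC.disjoint_mul_singleton h)
    (fun w _ => hC.measurableSet_mul_singleton _)]
  simp [measureReal_def]

omit [μ.IsHaarMeasure] in
theorem card_mul_le (hC : IsFundDomain Λ C) {B : Finset Λ} {S : Set G} (hS : μ S ≠ ⊤)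
    (h : ∀ w ∈ B, C * {(w : G)} ⊆ S) : B.card * μ.real C ≤ μ.real S := by
  rw [← hC.measureReal_biUnion μ]
  exact measureReal_mono (iUnion₂_subset h) hS

theorem le_card_mul (hC : IsFundDomain Λ C) {B : Finset Λ} {S : Set G}
    (h : S ⊆ ⋃ w ∈ B, C * {(w : G)}) : μ.real S ≤ B.card * μ.real C := by
  rw [← hC.measureReal_biUnion μ]
  refine measureReal_mono h ?_
  refine (measure_biUnion_lt_top B.finite_toSet fun w _ => ?_).ne
  simpa using hC.measure_lt_top μ

end IsFundDomain

/-- The lattice elements `z` for which `P * z` meets `A`. -/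
def latticeHits (Λ : Subgroup G) (P A : Set G) : Set Λ := {z | ∃ p ∈ P, p * (z : G) ∈ A}

omit [MeasurableSpace G] in
theorem finite_latticeHits [IsTopologicalGroup G] [T2Space G] [DiscreteTopology Λ] {P A : Set G}
    (hP : IsCompact P) (hA : IsCompact A) : (latticeHits Λ P A).Finite := by
  have hcl : IsClosed (Λ : Set G) := Subgroup.isClosed_of_discrete
  have hcpt : IsCompact (((↑) : Λ → G) ⁻¹' (P⁻¹ * A)) :=
    hcl.isClosedEmbedding_subtypeVal.isCompact_preimage (hP.inv.mul hA)
  refine hcpt.finite_of_discrete.subset ?_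
  rintro z ⟨p, hp, hpz⟩
  exact ⟨p⁻¹, inv_mem_inv.2 hp, _, hpz, by simp⟩

variable [BorelSpace G] [IsTopologicalGroup G] [T2Space G]
  (μ : Measure G) [μ.IsHaarMeasure] [μ.IsMulRightInvariant]

omit [BorelSpace G] [μ.IsMulRightInvariant] in
theorem measure_kBoundary_ne_top {K A : Set G} (hK : IsCompact K) (hA : IsCompact A) :
    μ (kBoundary K A) ≠ ⊤ := by
  refine ((measure_mono inter_subset_left).trans_lt (IsCompact.measure_lt_top ?_)).ne
  rw [hA.isClosed.closure_eq]
  exact hK.mul hA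

variable {μ}

/-- If `w = z v` with `p v ∈ A`, then `c w = (c z p⁻¹)(p v)`, while `c w ∉ A` because `w` is not a
hit. So the disjoint tiles of `z • F \ F` lie in this boundary. -/
theorem IsFundDomain.card_smul_sdiff_le [DecidableEq Λ] (hC : IsFundDomain Λ C) {A : Set G}
    (hA : IsCompact A) {F : Finset Λ} (hF : (F : Set Λ) = latticeHits Λ (closure C) A) (z : Λ) :
    ((z • F \ F).card : ℝ) * μ.real C ≤
      μ.real (kBoundary (insert 1 (closure C * {(z : G)} * (closure C)⁻¹)) A) := by
  have hP := hC.isCompact_closure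
  refine hC.card_mul_le μ (measure_kBoundary_ne_top μ
    (((hP.mul isCompact_singleton).mul hP.inv).insert 1) hA) fun w hw x hx => ?_
  obtain ⟨c, hc, rfl⟩ := mem_mul_singleton.1 hx
  obtain ⟨hw1, hw2⟩ := Finset.mem_sdiff.1 hw
  obtain ⟨v, hv, rfl⟩ := Finset.mem_smul_finset.1 hw1
  rw [← Finset.mem_coe, hF] at hv hw2
  obtain ⟨p, hp, hpv⟩ := hv
  refine mem_kBoundary_of_notMem (mem_insert _ _) ?_ fun h => hw2 ⟨c, subset_closure hc, h⟩
  refine ⟨c * z * p⁻¹, Or.inr ⟨_, ⟨c, subset_closure hc, z, rfl, rfl⟩, p⁻¹, inv_mem_inv.2 hp, rfl⟩,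
    _, hpv, ?_⟩
  simp [mul_assoc]

omit [T2Space G] in
theorem IsFundDomain.measureReal_le_card_mul (hC : IsFundDomain Λ C) {A : Set G}
    {F : Finset Λ} (hF : (F : Set Λ) = latticeHits Λ (closure C) A) :
    μ.real A ≤ F.card * μ.real C := by
  refine hC.le_card_mul μ fun x hx => ?_
  obtain ⟨c, hc, z, rfl⟩ := hC.exists_mul x
  refine mem_iUnion₂.2 ⟨z, ?_, mem_mul_singleton.2 ⟨c, hc, rfl⟩⟩
  rw [← Finset.mem_coe, hF]
  exact ⟨c, subset_closure hc, hx⟩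

omit [BorelSpace G] [IsTopologicalGroup G] [T2Space G] in
theorem IsFundDomain.one_mem_mul_inv (hC : IsFundDomain Λ C) :
    (1 : G) ∈ closure C * (closure C)⁻¹ := by
  obtain ⟨c, hc⟩ := hC.nonempty
  exact ⟨c, subset_closure hc, c⁻¹, inv_mem_inv.2 (subset_closure hc), mul_inv_cancel c⟩

theorem IsFundDomain.card_mul_le_measureReal_add (hC : IsFundDomain Λ C) {A : Set G}
    (hA : IsCompact A) {F : Finset Λ} (hF : (F : Set Λ) = latticeHits Λ (closure C) A) :
    F.card * μ.real C ≤ μ.real A + μ.real (kBoundary (closure C * (closure C)⁻¹) A) := by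
  have hP := hC.isCompact_closure
  have hb := measure_kBoundary_ne_top μ (hP.mul hP.inv) hA
  refine le_trans (hC.card_mul_le μ (measure_union_lt_top hA.measure_lt_top
    hb.lt_top).ne fun w hw x hx => ?_) (measureReal_union_le _ _)
  obtain ⟨c, hc, rfl⟩ := mem_mul_singleton.1 hx
  rw [← Finset.mem_coe, hF] at hw
  obtain ⟨p, hp, hpw⟩ := hw
  by_cases hxA : c * (w : G) ∈ A
  · exact Or.inl hxA
  · refine Or.inr (mem_kBoundary_of_notMem hC.one_mem_mul_inv ?_ hxA)
    exact ⟨c * p⁻¹, ⟨c, subset_closure hc, p⁻¹, inv_mem_inv.2 hp, rfl⟩, _, hpw,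
      by simp [mul_assoc]⟩

theorem IsFundDomain.card_boundary_mul_le (hC : IsFundDomain Λ C) {A : Set G}
    (hA : IsCompact A) {B : Finset Λ}
    (hB : (B : Set Λ) ⊆ latticeHits Λ (closure C) A ∩ latticeHits Λ (closure C) Aᶜ) :
    B.card * μ.real C ≤ μ.real (kBoundary (closure C * (closure C)⁻¹) A) := by
  have hP := hC.isCompact_closure
  refine hC.card_mul_le μ (measure_kBoundary_ne_top μ (hP.mul hP.inv) hA) fun w hw x hx => ?_
  obtain ⟨c, hc, rfl⟩ := mem_mul_singleton.1 hx
  obtain ⟨⟨p, hp, hpw⟩, ⟨q, hq, hqw⟩⟩ := hB hw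
  exact mem_kBoundary
    ⟨c * p⁻¹, ⟨c, subset_closure hc, p⁻¹, inv_mem_inv.2 hp, rfl⟩, _, hpw, by simp [mul_assoc]⟩
    ⟨c * q⁻¹, ⟨c, subset_closure hc, q⁻¹, inv_mem_inv.2 hq, rfl⟩, _, hqw, by simp [mul_assoc]⟩

omit [MeasurableSpace G] [BorelSpace G] [T2Space G] in
theorem apply_union_mul_le {f : Set G → ℝ} (hf_sub : SubadditiveOnCompacts f)
    (hf_inv : RightInvariantOnCompacts f) {A P : Set G} (hA : IsCompact A) (hAne : A.Nonempty)
    (hP : IsCompact P) (hPne : P.Nonempty) (B : Finset Λ) :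
    f (A ∪ P * (((↑) : Λ → G) '' B)) ≤ f A + B.card * f P := by
  classical
  induction B using Finset.induction_on with
  | empty => simp
  | insert b B hb ih =>
    have hcB : IsCompact (P * (((↑) : Λ → G) '' B)) :=
      hP.mul (B.finite_toSet.image _).isCompact
    have hcb : IsCompact (P * {(b : G)}) := hP.mul isCompact_singleton
    rw [Finset.card_insert_of_notMem hb, Finset.coe_insert, image_insert_eq, insert_eq, mul_union,
      union_left_comm, union_comm]
    have := hf_sub _ _ (hA.union hcB) (hAne.mono subset_union_left) hcb
      (hPne.mul (singleton_nonempty _))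
    rw [hf_inv P hP hPne] at this
    push_cast
    linarith

variable {I : Type*} [Preorder I] {A : I → Set G}

omit [BorelSpace G] [IsTopologicalGroup G] [T2Space G] [μ.IsMulRightInvariant] in
theorem IsVanHoveNet.eventually_pos (hA : IsVanHoveNet μ A) :
    ∀ᶠ i in atTop, 0 < μ.real (A i) := by
  obtain ⟨j, hj⟩ := hA.finally_somewhere_dense
  refine (eventually_ge_atTop j).mono fun i hi => ?_
  refine ENNReal.toReal_pos ?_ (hA.isCompact i).measure_lt_top.ne
  exact (Measure.measure_pos_of_nonempty_interior μ (hj i hi)).ne'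

/-- Finitely many translates of `C` cover a compact neighbourhood of `1`, which has positive
measure. -/
theorem IsFundDomain.measureReal_pos [LocallyCompactSpace G] [DiscreteTopology Λ]
    (hC : IsFundDomain Λ C) : 0 < μ.real C := by
  obtain ⟨K, hK, hK1⟩ := exists_compact_mem_nhds (1 : G)
  have hfin := finite_latticeHits (Λ := Λ) hC.isCompact_closure hK
  have h1 : μ.real K ≤ hfin.toFinset.card * μ.real C :=
    hC.measureReal_le_card_mul hfin.coe_toFinset
  have h2 : 0 < μ.real K :=
    ENNReal.toReal_pos (Measure.measure_pos_of_mem_nhds μ hK1).ne' hK.measure_lt_top.ne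
  exact pos_of_mul_pos_right (h2.trans_le h1) (Nat.cast_nonneg _)

theorem IsVanHoveNet.tendsto_latticeHits [LocallyCompactSpace G] [DiscreteTopology Λ]
    [DecidableEq Λ] (hC : IsFundDomain Λ C) (hA : IsVanHoveNet μ A) {F : I → Finset Λ}
    (hF : ∀ i, (F i : Set Λ) = latticeHits Λ (closure C) (A i)) :
    Tendsto F atTop (invariantFilter Λ) := by
  have hCpos : 0 < μ.real C := hC.measureReal_pos
  refine OrnsteinWeiss.tendsto_invariantFilter ?_ fun k => ?_
  · filter_upwards [hA.eventually_pos] with i hi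
    have := hi.trans_le (hC.measureReal_le_card_mul (μ := μ) (hF i))
    exact Finset.card_pos.1 (by exact_mod_cast pos_of_mul_pos_left this hCpos.le)
  · have hP := hC.isCompact_closure
    refine squeeze_zero' (Eventually.of_forall fun i => by positivity) ?_
      (hA.tendsto_boundary _ (((hP.mul (isCompact_singleton (x := (k : G)))).mul hP.inv).insert 1))
    filter_upwards [hA.eventually_pos] with i hi
    have h1 := hC.measureReal_le_card_mul (μ := μ) (hF i)
    rw [← mul_div_mul_right _ _ hCpos.ne']
    exact div_le_div₀ measureReal_nonneg
      (hC.card_smul_sdiff_le (hA.isCompact i) (hF i) k) hi h1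

theorem IsVanHoveNet.tendsto_card_latticeHits [LocallyCompactSpace G] [DiscreteTopology Λ]
    (hC : IsFundDomain Λ C) (hA : IsVanHoveNet μ A) {F : I → Finset Λ}
    (hF : ∀ i, (F i : Set Λ) = latticeHits Λ (closure C) (A i)) :
    Tendsto (fun i => (F i).card / μ.real (A i)) atTop (𝓝 (1 / μ.real C)) := by
  have hCpos : 0 < μ.real C := hC.measureReal_pos
  have hP := hC.isCompact_closure
  have h : Tendsto (fun i => (F i).card * μ.real C / μ.real (A i)) atTop (𝓝 1) := by
    refine tendsto_of_tendsto_of_tendsto_of_le_of_le' tendsto_const_nhds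
      (h := fun i => 1 + μ.real (kBoundary (closure C * (closure C)⁻¹) (A i)) / μ.real (A i))
      (by simpa using (hA.tendsto_boundary _ (hP.mul hP.inv)).const_add 1) ?_ ?_
    · filter_upwards [hA.eventually_pos] with i hi
      rw [one_le_div hi]
      exact hC.measureReal_le_card_mul (hF i)
    · filter_upwards [hA.eventually_pos] with i hi
      rw [div_le_iff₀ hi, add_mul, div_mul_cancel₀ _ hi.ne', one_mul]
      exact hC.card_mul_le_measureReal_add (hA.isCompact i) (hF i)
  refine (h.div_const (μ.real C)).congr fun i => ?_
  field_simp

theorem IsVanHoveNet.tendsto_of_tendsto_lattice [LocallyCompactSpace G] [DiscreteTopology Λ]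
    [DecidableEq Λ] {f : Set G → ℝ} (hf_sub : SubadditiveOnCompacts f)
    (hf_inv : RightInvariantOnCompacts f) (hf_mono : MonotoneOnCompacts f)
    (hC : IsFundDomain Λ C) (hA : IsVanHoveNet μ A) {M : ℝ}
    (hM : Tendsto (fun F : Finset Λ => f (closure C * (((↑) : Λ → G) '' F)) / F.card)
      (invariantFilter Λ) (𝓝 M)) :
    Tendsto (fun i => f (A i) / μ.real (A i)) atTop (𝓝 (1 / μ.real C * M)) := by
  classical
  have hCpos : 0 < μ.real C := hC.measureReal_pos
  have hP := hC.isCompact_closure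
  have hPne : (closure C).Nonempty := hC.nonempty.closure
  have hfin := fun i => finite_latticeHits (Λ := Λ) hP (hA.isCompact i)
  set F : I → Finset Λ := fun i => (hfin i).toFinset with hFdef
  have hF : ∀ i, (F i : Set Λ) = latticeHits Λ (closure C) (A i) :=
    fun i => (hfin i).coe_toFinset
  -- Lattice points whose closed tile meets both `A i` and its complement. They give `A i ⊆ P * F i
  -- ⊆ A i ∪ P * B i`, which drives the sandwich.
  set B : I → Finset Λ := fun i => {z ∈ F i | z ∈ latticeHits Λ (closure C) (A i)ᶜ} with hB
  set P := closure C
  have hBb : Tendsto (fun i => (B i).card * f P / μ.real (A i)) atTop (𝓝 0) := by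
    have h1 : Tendsto (fun i => ((B i).card : ℝ) * μ.real C / μ.real (A i)) atTop (𝓝 0) := by
      refine squeeze_zero (fun i => by positivity) (fun i => ?_)
        (hA.tendsto_boundary _ (hP.mul hP.inv))
      refine div_le_div_of_nonneg_right ?_ measureReal_nonneg
      refine hC.card_boundary_mul_le (hA.isCompact i) fun z hz => ?_
      have := Finset.mem_filter.1 (Finset.mem_coe.1 hz)
      exact ⟨by rw [← hF i]; exact this.1, this.2⟩
    have h2 := h1.mul_const (f P / μ.real C)
    rw [zero_mul] at h2
    refine h2.congr fun i => ?_
    field_simp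
  have hu : Tendsto (fun i => f (P * (((↑) : Λ → G) '' F i)) / μ.real (A i)) atTop
      (𝓝 (1 / μ.real C * M)) := by
    have hFt := hA.tendsto_latticeHits hC hF
    have hFne : ∀ᶠ i in atTop, (F i).Nonempty := by
      refine hFt.eventually (mem_invariantFilter.2 ⟨∅, 1, one_pos, fun A h _ => h⟩)
    refine ((hA.tendsto_card_latticeHits hC hF).mul (hM.comp hFt)).congr' ?_
    filter_upwards [hFne] with i hi
    have : ((F i).card : ℝ) ≠ 0 := Nat.cast_ne_zero.2 hi.card_pos.ne'
    simp only [Function.comp_apply]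
    field_simp
  refine tendsto_of_tendsto_of_tendsto_of_le_of_le' (by simpa using hu.sub hBb) hu ?_ ?_
  · filter_upwards [hA.eventually_pos] with i hi
    have hAne : (A i).Nonempty := by
      rw [nonempty_iff_ne_empty]; intro h; simp [h] at hi
    rw [← sub_div]
    refine div_le_div_of_nonneg_right ?_ hi.le
    have hsub : P * (((↑) : Λ → G) '' F i) ⊆ A i ∪ P * (((↑) : Λ → G) '' B i) := by
      rintro _ ⟨p, hp, _, ⟨z, hz, rfl⟩, rfl⟩
      by_cases h : p * (z : G) ∈ A i
      · exact Or.inl h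
      · exact Or.inr ⟨p, hp, z, ⟨z, Finset.mem_filter.2 ⟨hz, p, hp, h⟩, rfl⟩, rfl⟩
    have hne : (P * (((↑) : Λ → G) '' F i)).Nonempty := by
      obtain ⟨a, ha⟩ := hAne
      obtain ⟨c, hc, z, rfl⟩ := hC.exists_mul a
      refine ⟨_, c, subset_closure hc, z, ⟨z, ?_, rfl⟩, rfl⟩
      rw [hF i]; exact ⟨c, subset_closure hc, ha⟩
    have h1 := hf_mono _ _ (hP.mul ((F i).finite_toSet.image _).isCompact) hne
      ((hA.isCompact i).union (hP.mul ((B i).finite_toSet.image _).isCompact)) hsub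
    have h2 := apply_union_mul_le hf_sub hf_inv (hA.isCompact i) hAne hP hPne (B i)
    linarith
  · filter_upwards [hA.eventually_pos] with i hi
    have hAne : (A i).Nonempty := by
      rw [nonempty_iff_ne_empty]; intro h; simp [h] at hi
    refine div_le_div_of_nonneg_right ?_ hi.le
    refine hf_mono _ _ (hA.isCompact i) hAne
      (hP.mul ((F i).finite_toSet.image _).isCompact) fun x hx => ?_
    obtain ⟨c, hc, z, rfl⟩ := hC.exists_mul x
    refine ⟨c, subset_closure hc, z, ⟨z, ?_, rfl⟩, rfl⟩
    rw [hF i]; exact ⟨c, subset_closure hc, hx⟩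

omit [MeasurableSpace G] [BorelSpace G] [T2Space G] in
theorem exists_tendsto_lattice [DecidableEq Λ] [(invariantFilter Λ).NeBot] {f : Set G → ℝ}
    (hf_sub : SubadditiveOnCompacts f) (hf_inv : RightInvariantOnCompacts f)
    {P : Set G} (hP : IsCompact P) (hPne : P.Nonempty) :
    ∃ M : ℝ, Tendsto (fun F : Finset Λ => f (P * (((↑) : Λ → G) '' F)) / F.card)
      (invariantFilter Λ) (𝓝 M) := by
  have hc : ∀ F : Finset Λ, IsCompact (P * (((↑) : Λ → G) '' F)) :=
    fun F => hP.mul (F.finite_toSet.image _).isCompact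
  have hn : ∀ F : Finset Λ, F.Nonempty → (P * (((↑) : Λ → G) '' F)).Nonempty :=
    fun F hF => hPne.mul ((Finset.coe_nonempty.2 hF).image _)
  -- The value `f ∅` is arbitrary, so it is replaced by `0` to make the discrete result applicable.
  set g : Finset Λ → ℝ := fun F => if F.Nonempty then f (P * (((↑) : Λ → G) '' F)) else 0 with hg
  have hg' : ∀ F : Finset Λ, F.Nonempty → g F = f (P * (((↑) : Λ → G) '' F)) :=
    fun F hF => if_pos hF
  have hg0 : g ∅ = 0 := by simp [hg]
  obtain ⟨M, hM⟩ := exists_tendsto_invariantFilter (f := g) hg0 (fun F => by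
      rcases F.eq_empty_or_nonempty with rfl | h
      · exact hg0.ge
      · rw [hg' F h]; exact hf_sub.nonneg (hc F) (hn F h))
    (fun F F' => by
      rcases F.eq_empty_or_nonempty with rfl | h
      · simp [hg0]
      rcases F'.eq_empty_or_nonempty with rfl | h'
      · simp [hg0]
      rw [hg' F h, hg' F' h', hg' _ (h.mono Finset.subset_union_left), Finset.coe_union,
        image_union, mul_union]
      exact hf_sub _ _ (hc F) (hn F h) (hc F') (hn F' h'))
    (fun F z => by
      rcases F.eq_empty_or_nonempty with rfl | h
      · simp
      rw [hg' F h, hg' _ (h.mul (Finset.singleton_nonempty z)), ← hf_inv _ (hc F) (hn F h) (z : G),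
        mul_assoc]
      congr 2
      rw [Finset.coe_mul, Finset.coe_singleton]
      exact (image_mul Λ.subtype).trans (by simp))
  refine ⟨M, hM.congr' ?_⟩
  have : ∀ᶠ F in invariantFilter Λ, F.Nonempty :=
    mem_invariantFilter.2 ⟨∅, 1, one_pos, fun A h _ => h⟩
  filter_upwards [this] with F hF
  rw [hg' F hF]

end Transfer

end OrnsteinWeiss

/-! ### The main theorem -/

theorem mainTheorem1 {G : Type u} [Group G] [TopologicalSpace G] [IsTopologicalGroup G]
    [T2Space G] [LocallyCompactSpace G] [MeasurableSpace G] [BorelSpace G]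
    (μ : Measure G) [μ.IsHaarMeasure] [μ.IsMulRightInvariant] [μ.Regular]
    (hG : OrnsteinWeiss.IsAmenable μ)
    (hL : ∃ Λ : Subgroup G, OrnsteinWeiss.IsUniformLattice Λ)
    (f : Set G → ℝ)
    (hf_sub : OrnsteinWeiss.SubadditiveOnCompacts f)
    (hf_inv : OrnsteinWeiss.RightInvariantOnCompacts f)
    (hf_mono : OrnsteinWeiss.MonotoneOnCompacts f) :
    ∃ L : ℝ,
      (∀ (I : Type v) [Preorder I] [IsDirectedOrder I] [Nonempty I] (A : I → Set G),
        OrnsteinWeiss.IsVanHoveNet μ A →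
          Tendsto (fun i => f (A i) / μ.real (A i)) atTop (𝓝 L)) ∧
      (∀ (Λ : Subgroup G), OrnsteinWeiss.IsUniformLattice Λ →
        ∀ (C : Set G), OrnsteinWeiss.IsFundDomain Λ C →
        ∀ (J : Type w) [Preorder J] [IsDirectedOrder J] [Nonempty J] (F : J → Set Λ),
          OrnsteinWeiss.IsVanHoveNet (Measure.count : Measure Λ) F →
          ∃ M : ℝ,
            Tendsto (fun j => f (closure C * (Subtype.val '' F j)) / ((F j).ncard : ℝ))
              atTop (𝓝 M) ∧
            L = 1 / μ.real C * M) := by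
  classical
  obtain ⟨I₀, _, _, _, A₀, hA₀⟩ := hG
  have key : ∀ (Λ : Subgroup G), OrnsteinWeiss.IsUniformLattice Λ →
      ∀ (C : Set G), OrnsteinWeiss.IsFundDomain Λ C → ∃ M : ℝ,
        Tendsto (fun F : Finset Λ => f (closure C * (((↑) : Λ → G) '' F)) / F.card)
          (OrnsteinWeiss.invariantFilter Λ) (𝓝 M) := by
    intro Λ hΛ C hC
    have := hΛ.discrete
    have hfin := fun i =>
      OrnsteinWeiss.finite_latticeHits (Λ := Λ) hC.isCompact_closure (hA₀.isCompact i)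
    -- Amenability passes to `Λ`: the hit sets of a Van Hove net in `G` show that the invariant
    -- filter is nontrivial.
    have := (hA₀.tendsto_latticeHits hC (F := fun i => (hfin i).toFinset)
      fun i => (hfin i).coe_toFinset).neBot
    exact OrnsteinWeiss.exists_tendsto_lattice hf_sub hf_inv hC.isCompact_closure
      hC.nonempty.closure
  obtain ⟨Λ₀, hΛ₀⟩ := hL
  obtain ⟨C₀, hC₀⟩ := hΛ₀.exists_isFundDomain
  obtain ⟨M₀, hM₀⟩ := key Λ₀ hΛ₀ C₀ hC₀
  have := hΛ₀.discrete
  refine ⟨1 / μ.real C₀ * M₀, fun I _ _ _ A hA =>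
    hA.tendsto_of_tendsto_lattice hf_sub hf_inv hf_mono hC₀ hM₀, ?_⟩
  intro Λ hΛ C hC J _ _ _ F hF
  have := hΛ.discrete
  obtain ⟨M, hM⟩ := key Λ hΛ C hC
  refine ⟨M, (hM.comp hF.tendsto_invariantFilter).congr fun j => ?_, ?_⟩
  · simp only [Function.comp_apply, Finite.coe_toFinset,
      ncard_eq_toFinset_card _ ((hF.isCompact j).finite_of_discrete)]
  · exact tendsto_nhds_unique
      (hA₀.tendsto_of_tendsto_lattice hf_sub hf_inv hf_mono hC₀ hM₀)
      (hA₀.tendsto_of_tendsto_lattice hf_sub hf_inv hf_mono hC hM)
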